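/- For $\beta\in(1,2)$ let $f_\beta(x)=\beta x \bmod 1$ (the fractional part of $\beta x$). For $x\in[0,1]$ define the digits of its $\beta$-expansion by $d_n(x,\beta)=\lfloor \beta f_\beta^{\,n}(x)\rfloor$, $n\ge 0$. We say that the expansion of $1$ terminates if there is a $k$ such that $d_n(1,\beta)=0$ for all $n\ge k$. For $x\in[0,1]$ put $$G_{f_\beta}(x)=\Big\{\,y\in[0,1) : x\notin\overline{\{f_\beta^{\,n}(y): n\ge 0\}}\,\Big\},$$ where the closure is taken in $\mathbb R$. Let $(\beta_i)_{i=1}^\infty$ be a sequence in $(1,2)$ such that the expansion of $1$ terminates for each $\beta_i$, and let $(x_i)_{i=1}^\infty$ be a sequence of points in $[0,1]$. Then $$\dim_H\Big(\bigcap_{i=1}^\infty G_{f_{\beta_i}}(x_i)\Big)=1,$$ where $\dim_H$ denotes Hausdorff dimension. -/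

import Mathlib

/-- The map `f_β(x) = β x mod 1`, i.e. the fractional part of `β x`. -/
noncomputable def betaMap (β : ℝ) (x : ℝ) : ℝ := Int.fract (β * x)

/-- The `n`-th digit (counted from `n = 0`) of the `β`-expansion of `x`, i.e. the integer part
of `β f_β^n(x)`. -/
noncomputable def betaDigit (x β : ℝ) (n : ℕ) : ℤ := ⌊β * (betaMap β)^[n] x⌋

/-- The `β`-expansion of `1` terminates: its digits are eventually all zero. -/
def OneExpansionTerminates (β : ℝ) : Prop :=
  ∃ k : ℕ, ∀ n : ℕ, k ≤ n → betaDigit 1 β n = 0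

/-- `G_f(x)`: the points `y ∈ [0,1)` such that `x` is not in the closure of the forward orbit
`{f^n(y) : n ≥ 0}` of `y`. -/
def avoidingSet (f : ℝ → ℝ) (x : ℝ) : Set ℝ :=
  {y | y ∈ Set.Ico (0 : ℝ) 1 ∧ x ∉ closure (Set.range fun n : ℕ => f^[n] y)}

/-! For each `i`, delete every point whose `β i`-orbit comes `δ i`-close to `x i`; apart from the
point `1`, what is left of `[0, 1]` lies in the intersection. Since the orbit of `1` is finite, the
images of the laps of the `n`-th iterate have lengths bounded below, so an interval of length
comparable to `β⁻ⁿ` meets boundedly many laps. On each lap the visits to a small neighbourhood of `x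
i` fill a tiny interval. The deleted sets are thus sparse (`exists_isSparseAt_visitSet`): on an
`M`-adic interval of level `p` they consist of at most `R` pieces of size `M⁻⁽ᵖ⁺q⁾`, with `R`
independent of `q`. Taking `q i` large makes the total loss summable over `i`.

For the dimension bound, a countable cover with small `s`-sum is deleted as well. With `M = D + 2`
and `M ^ s ≤ D`, the sparse sets and the cover each cost at most one child's worth per survivor, so
at least `D ^ k` intervals survive at level `k` (`mul_le_succ_of_removal`). By compactness some
point is not covered, a contradiction; hence the dimension is at least every `s < 1`. -/

/-! ### `M`-adic intervals and the tree of survivors. -/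

/-- The closed `M`-adic interval of level `k` with index `j`. -/
def adicInterval (M k j : ℕ) : Set ℝ :=
  Set.Icc ((j : ℝ) / (M : ℝ) ^ k) (((j : ℝ) + 1) / (M : ℝ) ^ k)

lemma adicInterval_succ_subset {M : ℕ} (hM : 0 < M) (k j : ℕ) :
    adicInterval M (k + 1) j ⊆ adicInterval M k (j / M) := by
  have hM' : (0 : ℝ) < M := by exact_mod_cast hM
  have h1 : M * (j / M) ≤ j := Nat.mul_div_le j M
  have h2 : j + 1 ≤ M * (j / M + 1) := Nat.lt_mul_div_succ j hM
  have h1' : (M : ℝ) * ((j / M : ℕ) : ℝ) ≤ j := by exact_mod_cast h1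
  have h2' : (j : ℝ) + 1 ≤ M * (((j / M : ℕ) : ℝ) + 1) := by exact_mod_cast h2
  apply Set.Icc_subset_Icc
  · rw [div_le_div_iff₀ (by positivity) (by positivity), pow_succ]
    have := mul_le_mul_of_nonneg_right h1' (by positivity : (0 : ℝ) ≤ (M : ℝ) ^ k)
    linarith
  · rw [div_le_div_iff₀ (by positivity) (by positivity), pow_succ]
    have := mul_le_mul_of_nonneg_right h2' (by positivity : (0 : ℝ) ≤ (M : ℝ) ^ k)
    linarith

lemma adicInterval_add_subset {M : ℕ} (hM : 0 < M) (p q j : ℕ) :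
    adicInterval M (p + q) j ⊆ adicInterval M p (j / M ^ q) := by
  induction q generalizing j with
  | zero => simp
  | succ q ih =>
    refine (adicInterval_succ_subset hM (p + q) j).trans ((ih (j / M)).trans ?_)
    rw [Nat.div_div_eq_div_mul, pow_succ']

/-- A set of diameter at most `M⁻ᵏ` meets at most four `M`-adic intervals of level `k`. -/
lemma card_meeting_adicInterval_le {M : ℕ} (hM : 0 < M) (k : ℕ) (g : Set ℝ)
    (hg : ∀ z ∈ g, ∀ w ∈ g, |z - w| ≤ ((M : ℝ) ^ k)⁻¹) (F : Finset ℕ)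
    (hF : ∀ j ∈ F, (adicInterval M k j ∩ g).Nonempty) : F.card ≤ 4 := by
  rcases g.eq_empty_or_nonempty with rfl | ⟨c, hc⟩
  · have : F = ∅ := by
      ext j
      simpa using fun hj => by simpa using hF j hj
    simp [this]
  have hM' : (0 : ℝ) < (M : ℝ) ^ k := by positivity
  -- Scaled by `M ^ k`, every admissible `j` lies in a closed window of length 3.
  have key : F.card ≤ (Finset.Icc ⌈c * (M : ℝ) ^ k - 2⌉ ⌊c * (M : ℝ) ^ k + 1⌋).card := by
    refine Finset.card_le_card_of_injOn (fun j : ℕ => (j : ℤ)) ?_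
      (Nat.cast_injective.injOn)
    intro j hj
    obtain ⟨z, ⟨hz1, hz2⟩, hz⟩ := hF j hj
    have h := abs_le.1 (hg z hz c hc)
    rw [div_le_iff₀ hM'] at hz1
    rw [le_div_iff₀ hM'] at hz2
    have e1 := mul_le_mul_of_nonneg_right h.1 hM'.le
    have e2 := mul_le_mul_of_nonneg_right h.2 hM'.le
    have e3 : ((M : ℝ) ^ k)⁻¹ * (M : ℝ) ^ k = 1 := inv_mul_cancel₀ hM'.ne'
    simp only [Finset.coe_Icc, Set.mem_Icc, Int.ceil_le, Int.le_floor, Int.cast_natCast]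
    constructor <;> linarith
  refine key.trans ?_
  rw [Int.card_Icc]
  have h1 := Int.le_ceil (c * (M : ℝ) ^ k - 2)
  have h2 := Int.floor_le (c * (M : ℝ) ^ k + 1)
  have h3 : ((⌊c * (M : ℝ) ^ k + 1⌋ : ℤ) : ℝ) ≤ ((⌈c * (M : ℝ) ^ k - 2⌉ + 3 : ℤ) : ℝ) := by
    push_cast; linarith
  have h4 : ⌊c * (M : ℝ) ^ k + 1⌋ ≤ ⌈c * (M : ℝ) ^ k - 2⌉ + 3 := by exact_mod_cast h3
  omega

open Classical in
/-- The indices of the `M`-adic intervals of level `k` none of whose ancestors, including the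
interval itself, is bad. -/
noncomputable def survivors (M : ℕ) (Bad : ℕ → Set ℕ) : ℕ → Finset ℕ
  | 0 => {0}
  | k + 1 => (Finset.range (M ^ (k + 1))).filter
      fun j => j / M ∈ survivors M Bad k ∧ j ∉ Bad (k + 1)

lemma mem_survivors_succ {M : ℕ} {Bad : ℕ → Set ℕ} {k j : ℕ} :
    j ∈ survivors M Bad (k + 1) ↔
      j < M ^ (k + 1) ∧ j / M ∈ survivors M Bad k ∧ j ∉ Bad (k + 1) := by
  simp [survivors]

lemma lt_pow_of_mem_survivors {M : ℕ} {Bad : ℕ → Set ℕ} {k j : ℕ}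
    (h : j ∈ survivors M Bad k) : j < M ^ k := by
  cases k with
  | zero => simp [survivors] at h; simp [h]
  | succ k => exact (mem_survivors_succ.1 h).1

lemma div_pow_mem_survivors {M : ℕ} {Bad : ℕ → Set ℕ} {p q j : ℕ}
    (h : j ∈ survivors M Bad (p + q)) : j / M ^ q ∈ survivors M Bad p := by
  induction q generalizing j with
  | zero => simpa using h
  | succ q ih =>
    rw [← add_assoc, mem_survivors_succ] at h
    have := ih h.2.1
    rwa [Nat.div_div_eq_div_mul, ← pow_succ'] at this

/-- The children of the survivors of level `k`. -/
def survivorChildren (M : ℕ) (A : Finset ℕ) : Finset ℕ :=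
  A.biUnion fun a => Finset.Ico (M * a) (M * a + M)

lemma mem_survivorChildren {M : ℕ} (hM : 0 < M) {A : Finset ℕ} {j : ℕ} :
    j ∈ survivorChildren M A ↔ j / M ∈ A := by
  simp only [survivorChildren, Finset.mem_biUnion, Finset.mem_Ico]
  constructor
  · rintro ⟨a, ha, h1, h2⟩
    have : j / M = a := by
      rw [Nat.div_eq_iff hM, mul_comm a M]
      omega
    rwa [this]
  · intro h
    exact ⟨_, h, Nat.mul_div_le j M, by 
      have := Nat.lt_mul_div_succ j hM
      rwa [mul_add, mul_one] at this⟩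

lemma card_survivorChildren {M : ℕ} (hM : 0 < M) (A : Finset ℕ) :
    (survivorChildren M A).card = M * A.card := by
  rw [survivorChildren, Finset.card_biUnion]
  · simp [mul_comm]
  · intro a _ b _ hab
    rw [Function.onFun, Finset.disjoint_left]
    intro j h1 h2
    rw [Finset.mem_Ico] at h1 h2
    apply hab
    have e1 : j / M = a := by rw [Nat.div_eq_iff hM, mul_comm a M]; omega
    have e2 : j / M = b := by rw [Nat.div_eq_iff hM, mul_comm b M]; omega
    exact e1.symm.trans e2

open Classical in
lemma mul_card_survivors_le {M : ℕ} (hM : 0 < M) (Bad : ℕ → Set ℕ) (k : ℕ) :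
    M * (survivors M Bad k).card ≤ (survivors M Bad (k + 1)).card +
      ((survivorChildren M (survivors M Bad k)).filter (· ∈ Bad (k + 1))).card := by
  rw [← card_survivorChildren hM, ← Finset.card_filter_add_card_filter_not (· ∈ Bad (k + 1)),
    add_comm]
  refine Nat.add_le_add_right (Finset.card_le_card ?_) _
  intro j
  simp only [Finset.mem_filter, mem_survivors_succ, mem_survivorChildren hM]
  rintro ⟨h1, h2⟩
  refine ⟨?_, h1, h2⟩
  have := lt_pow_of_mem_survivors h1
  rwa [Nat.div_lt_iff_lt_mul hM, ← pow_succ] at this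

/-- If each level has a survivor, some point of `[0, 1]` lies, for each level, in a surviving
interval of that level. -/
lemma exists_forall_mem_adicInterval {M : ℕ} (hM : 0 < M) (Bad : ℕ → Set ℕ)
    (h : ∀ k, (survivors M Bad k).Nonempty) :
    ∃ y ∈ Set.Icc (0 : ℝ) 1, ∀ k, ∃ j ∈ survivors M Bad k, y ∈ adicInterval M k j := by
  let K : ℕ → Set ℝ := fun k => ⋃ j ∈ survivors M Bad k, adicInterval M k j
  have hK : ∀ k, IsCompact (K k) := fun k =>
    (survivors M Bad k).isCompact_biUnion fun j _ => isCompact_Icc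
  obtain ⟨y, hy⟩ := IsCompact.nonempty_iInter_of_sequence_nonempty_isCompact_isClosed K
    (fun k => by
      intro y hy
      simp only [K, Set.mem_iUnion, exists_prop] at hy ⊢
      obtain ⟨j, hj, hy⟩ := hy
      rw [mem_survivors_succ] at hj
      exact ⟨j / M, hj.2.1, adicInterval_succ_subset hM k j hy⟩)
    (fun k => by
      obtain ⟨j, hj⟩ := h k
      have hle : (j : ℝ) / (M : ℝ) ^ k ≤ ((j : ℝ) + 1) / (M : ℝ) ^ k := by gcongr; linarith
      exact ⟨_, Set.mem_biUnion (t := fun j => adicInterval M k j) hj (Set.left_mem_Icc.2 hle)⟩)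
    (hK 0) (fun k => (hK k).isClosed)
  have hy' : ∀ k, ∃ j ∈ survivors M Bad k, y ∈ adicInterval M k j := fun k => by
    simpa [K] using Set.mem_iInter.1 hy k
  refine ⟨y, ?_, hy'⟩
  obtain ⟨j, hj, hy0⟩ := hy' 0
  simp only [survivors, Finset.mem_singleton] at hj
  subst hj
  simpa [adicInterval] using hy0

/-! ### Counting survivors after deleting sparse sets and a cover. -/

/-- `Z` meets every `M`-adic interval of level `p` in a union of at most `R` sets of diameter at
most `M⁻⁽ᵖ⁺q⁾`. -/
def IsSparseAt (M p q R : ℕ) (Z : Set ℝ) : Prop :=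
  ∀ j : ℕ, ∃ G : Finset (Set ℝ), G.card ≤ R ∧
    (∀ z ∈ Z ∩ adicInterval M p j, ∃ g ∈ G, z ∈ g) ∧
    ∀ g ∈ G, ∀ z ∈ g, ∀ w ∈ g, |z - w| ≤ ((M : ℝ) ^ (p + q))⁻¹

/-- Each ancestor in `A` holds at most `R` pieces of `Z`, and each piece meets at most four
intervals of level `p + q`. -/
lemma IsSparseAt.card_le {M p q R : ℕ} {Z : Set ℝ} (hM : 0 < M) (h : IsSparseAt M p q R Z)
    (A F : Finset ℕ) (hFA : ∀ j ∈ F, j / M ^ q ∈ A)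
    (hF : ∀ j ∈ F, (adicInterval M (p + q) j ∩ Z).Nonempty) : F.card ≤ 4 * R * A.card := by
  classical
  choose G hG1 hG2 hG3 using h
  have hsub : F ⊆ A.biUnion fun a => (G a).biUnion fun g =>
      F.filter fun j => (adicInterval M (p + q) j ∩ g).Nonempty := by
    intro j hj
    obtain ⟨z, hz1, hz2⟩ := hF j hj
    obtain ⟨g, hg, hzg⟩ := hG2 (j / M ^ q) z ⟨hz2, adicInterval_add_subset hM p q j hz1⟩
    simp only [Finset.mem_biUnion, Finset.mem_filter]
    exact ⟨_, hFA j hj, g, hg, hj, z, hz1, hzg⟩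
  refine (Finset.card_le_card hsub).trans ?_
  rw [mul_comm]
  refine Finset.card_biUnion_le_card_mul _ _ _ fun a _ => ?_
  refine (Finset.card_biUnion_le_card_mul _ _ 4 fun g hg => ?_).trans ?_
  · exact card_meeting_adicInterval_le hM _ g (hG3 a g hg) _ fun j hj => (Finset.mem_filter.1 hj).2
  · rw [mul_comm 4]; exact Nat.mul_le_mul_right _ (hG1 a)

/-- A sequence that loses at each step a controlled part of its earlier values grows
geometrically. -/
lemma mul_le_succ_of_removal {D : ℕ} {a w q r : ℕ → ℕ} (h0 : a 0 = 1)
    (hq : ∀ i, i + 1 ≤ q i) (hr : ∀ i, r i * 2 ^ (i + 1) ≤ D ^ (q i - 1))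
    (hw : ∀ k, w k ≤ D ^ k)
    (h : ∀ k, (D + 2) * a k ≤ a (k + 1) +
      (∑ i ∈ (Finset.range (k + 1)).filter (fun i => q i ≤ k + 1), r i * a (k + 1 - q i) + w k))
    (k : ℕ) : D ^ k ≤ a k ∧ D * a k ≤ a (k + 1) := by
  induction k using Nat.strong_induction_on with
  | _ k ih =>
    have hgrow : ∀ l p, p + l ≤ k → D ^ l * a p ≤ a (p + l) := by
      intro l p
      induction l with
      | zero => simp
      | succ l ihl =>
        intro hl
        calc D ^ (l + 1) * a p = D * (D ^ l * a p) := by ring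
          _ ≤ D * a (p + l) := Nat.mul_le_mul_left _ (ihl (by omega))
          _ ≤ a (p + l + 1) := (ih (p + l) (by omega)).2
    have h1 : D ^ k ≤ a k := by simpa [h0] using hgrow k 0 (by omega)
    refine ⟨h1, ?_⟩
    -- Growth up to level `k` gives `a (k + 1 - q i) ≤ a k / D ^ (q i - 1)`, so term `i` is at most
    -- `a k / 2 ^ (i + 1)`. This sum and `w k ≤ D ^ k ≤ a k` use up the 2 in `D + 2`.
    have hsum : ((∑ i ∈ (Finset.range (k + 1)).filter (fun i => q i ≤ k + 1),
        r i * a (k + 1 - q i) : ℕ) : ℝ) ≤ a k := by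
      push_cast
      calc _ ≤ ∑ i ∈ (Finset.range (k + 1)).filter (fun i => q i ≤ k + 1),
            (a k : ℝ) * (1 / 2 : ℝ) ^ (i + 1) := by
            refine Finset.sum_le_sum fun i hi => ?_
            have hqi := (Finset.mem_filter.1 hi).2
            have := hq i
            have h2 : D ^ (q i - 1) * a (k + 1 - q i) ≤ a k := by
              have := hgrow (q i - 1) (k + 1 - q i) (by omega)
              rwa [show k + 1 - q i + (q i - 1) = k by omega] at this
            have h3 : r i * 2 ^ (i + 1) * a (k + 1 - q i) ≤ a k :=
              (Nat.mul_le_mul_right _ (hr i)).trans h2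
            have h4 : (r i : ℝ) * 2 ^ (i + 1) * a (k + 1 - q i) ≤ a k := by exact_mod_cast h3
            rw [one_div, inv_pow, ← div_eq_mul_inv, le_div_iff₀ (by positivity)]
            linarith
        _ ≤ ∑ i ∈ Finset.range (k + 1), (a k : ℝ) * (1 / 2 : ℝ) ^ (i + 1) :=
            Finset.sum_le_sum_of_subset_of_nonneg (Finset.filter_subset _ _)
              fun _ _ _ => by positivity
        _ = a k * (1 - (1 / 2 : ℝ) ^ (k + 1)) := by
            rw [← Finset.mul_sum]
            congr 1
            generalize k + 1 = n
            induction n with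
            | zero => simp
            | succ n ihn => rw [Finset.sum_range_succ, ihn]; ring
        _ ≤ a k := by
            have : (0 : ℝ) ≤ (1 / 2 : ℝ) ^ (k + 1) := by positivity
            nlinarith [(Nat.cast_nonneg (a k) : (0 : ℝ) ≤ a k)]
    have hsum' := Nat.cast_le.1 hsum
    have := h k
    have := hw k
    have e : (D + 2) * a k = D * a k + 2 * a k := by ring
    omega

/-- A countable family of sparse sets together with a countable family of small sets does not
cover `[0, 1]`. -/
theorem exists_avoiding_sparse {D : ℕ} (hD : 0 < D) (Z : ℕ → ℕ → Set ℝ) (R q : ℕ → ℕ)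
    (hZ : ∀ i p, IsSparseAt (D + 2) p (q i) (R i) (Z i p)) (hq : ∀ i, i + 1 ≤ q i)
    (hR : ∀ i, 4 * R i * 2 ^ (i + 1) ≤ D ^ (q i - 1))
    (t : ℕ → Set ℝ) (m : ℕ → ℕ) (hm : ∀ n, 1 ≤ m n)
    (ht : ∀ n, ∀ z ∈ t n, ∀ w ∈ t n, |z - w| ≤ (((D + 2 : ℕ) : ℝ) ^ m n)⁻¹)
    (N : ℕ → Finset ℕ) (hN : ∀ k n, m n = k + 1 → n ∈ N k)
    (hNcard : ∀ k, 4 * (N k).card ≤ D ^ k) :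
    ∃ y ∈ Set.Icc (0 : ℝ) 1, (∀ i p, y ∉ Z i p) ∧ ∀ n, y ∉ t n := by
  classical
  set M := D + 2 with hMdef
  have hM : 0 < M := by omega
  obtain ⟨Bad, hBad⟩ : ∃ Bad : ℕ → Set ℕ, ∀ k j, j ∈ Bad k ↔
      (∃ i p, p + q i = k ∧ (adicInterval M k j ∩ Z i p).Nonempty) ∨
        ∃ n, m n = k ∧ (adicInterval M k j ∩ t n).Nonempty := ⟨fun k => {j | _}, fun k j => Iff.rfl⟩
  have hrec : ∀ k, (D + 2) * (survivors M Bad k).card ≤ (survivors M Bad (k + 1)).card +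
      (∑ i ∈ (Finset.range (k + 1)).filter (fun i => q i ≤ k + 1),
        4 * R i * (survivors M Bad (k + 1 - q i)).card + 4 * (N k).card) := by
    intro k
    refine (mul_card_survivors_le hM Bad k).trans (Nat.add_le_add_left ?_ _)
    set C := survivorChildren M (survivors M Bad k) with hC
    have hsub : C.filter (· ∈ Bad (k + 1)) ⊆
        (((Finset.range (k + 1)).filter (fun i => q i ≤ k + 1)).biUnion fun i =>
          C.filter fun j => (adicInterval M (k + 1) j ∩ Z i (k + 1 - q i)).Nonempty) ∪
        (N k).biUnion fun n => if m n = k + 1 then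
          C.filter fun j => (adicInterval M (k + 1) j ∩ t n).Nonempty else ∅ := by
      intro j hj
      obtain ⟨hjC, hjB⟩ := Finset.mem_filter.1 hj
      rw [Finset.mem_union]
      rcases (hBad _ _).1 hjB with ⟨i, p, hp, hne⟩ | ⟨n, hn, hne⟩
      · left
        -- Only finitely many `i` act at a given level: `i + 1 ≤ q i ≤ k + 1`.
        have := hq i
        obtain rfl : p = k + 1 - q i := by omega
        simp only [Finset.mem_biUnion, Finset.mem_filter, Finset.mem_range]
        exact ⟨i, ⟨by omega, by omega⟩, hjC, hne⟩
      · right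
        refine Finset.mem_biUnion.2 ⟨n, hN k n hn, ?_⟩
        rw [if_pos hn]
        exact Finset.mem_filter.2 ⟨hjC, hne⟩
    refine (Finset.card_le_card hsub).trans ((Finset.card_union_le _ _).trans (add_le_add ?_ ?_))
    · refine Finset.card_biUnion_le.trans (Finset.sum_le_sum fun i hi => ?_)
      have hqi := (Finset.mem_filter.1 hi).2
      have hqi' := hq i
      refine (hZ i (k + 1 - q i)).card_le hM _ _ (fun j hj => ?_) fun j hj => ?_
      · have hj' := (mem_survivorChildren hM).1 (Finset.mem_filter.1 hj).1
        rw [show k = (k + 1 - q i) + (q i - 1) by omega] at hj'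
        have := div_pow_mem_survivors hj'
        rwa [Nat.div_div_eq_div_mul, ← pow_succ', show q i - 1 + 1 = q i by omega] at this
      · rw [show k + 1 - q i + q i = k + 1 by omega]
        exact (Finset.mem_filter.1 hj).2
    · rw [mul_comm]
      refine Finset.card_biUnion_le_card_mul _ _ 4 fun n _ => ?_
      split_ifs with hn
      · exact card_meeting_adicInterval_le hM (k + 1) (t n) (hn ▸ ht n) _
          fun j hj => (Finset.mem_filter.1 hj).2
      · simp
  have hgrow := mul_le_succ_of_removal (a := fun k => (survivors M Bad k).card)
    (w := fun k => 4 * (N k).card) (r := fun i => 4 * R i) (by simp [survivors]) hq hR hNcard hrec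
  obtain ⟨y, hy01, hy⟩ := exists_forall_mem_adicInterval hM Bad fun k =>
    Finset.card_pos.1 ((pow_pos hD k).trans_le (hgrow k).1)
  have hnb : ∀ k, 1 ≤ k → ∃ j, j ∉ Bad k ∧ y ∈ adicInterval M k j := by
    intro k hk
    obtain ⟨k, rfl⟩ := Nat.exists_eq_add_of_le' hk
    obtain ⟨j, hj, hyj⟩ := hy (k + 1)
    rw [mem_survivors_succ] at hj
    exact ⟨j, hj.2.2, hyj⟩
  refine ⟨y, hy01, fun i p hyZ => ?_, fun n hyt => ?_⟩
  · obtain ⟨j, hj, hyj⟩ := hnb (p + q i) (by have := hq i; omega)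
    exact hj ((hBad _ _).2 <| Or.inl ⟨i, p, rfl, y, hyj, hyZ⟩)
  · obtain ⟨j, hj, hyj⟩ := hnb (m n) (hm n)
    exact hj ((hBad _ _).2 <| Or.inr ⟨n, rfl, y, hyj, hyt⟩)

/-! ### Lower bound for the Hausdorff dimension. -/

/-- For each exponent `s < 1` there is a base that dominates its own `s`-th power with room to
spare. -/
lemma exists_nat_rpow_le {s : ℝ} (hs : s < 1) :
    ∃ D : ℕ, 2 ≤ D ∧ ((D + 2 : ℕ) : ℝ) ^ s ≤ D := by
  have h := (tendsto_rpow_atTop (sub_pos.2 hs)).comp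
    (tendsto_natCast_atTop_atTop (R := ℝ))
  -- `M ^ (1 - s) ≥ 2` and `M ≥ 4` give `M ^ s ≤ M / 2 ≤ M - 2`.
  obtain ⟨M, hM2, hM4⟩ := ((h.eventually_ge_atTop 2).and (Filter.eventually_ge_atTop 4)).exists
  obtain ⟨D, rfl⟩ := Nat.exists_eq_add_of_le' (show 2 ≤ M by omega)
  refine ⟨D, by omega, ?_⟩
  have hpos : (0 : ℝ) < ((D + 2 : ℕ) : ℝ) := by positivity
  have e : ((D + 2 : ℕ) : ℝ) ^ s * ((D + 2 : ℕ) : ℝ) ^ (1 - s) = D + 2 := by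
    rw [← Real.rpow_add hpos]; simp
  have h2 : (2 : ℝ) ≤ ((D + 2 : ℕ) : ℝ) ^ (1 - s) := hM2
  have h3 := mul_le_mul_of_nonneg_left h2 (Real.rpow_nonneg hpos.le s)
  have h4 : (2 : ℝ) ≤ D := by exact_mod_cast (show 2 ≤ D by omega)
  linarith

/-- A family of sets with small `s`-dimensional sum can be sorted into levels such that the sets
of level `m` have diameter at most `M⁻ᵐ`, and there are few of them. -/
lemma exists_level_of_tsum_lt {s : ℝ} (hs : 0 < s) {D : ℕ} (hD : 2 ≤ D)
    (hDs : ((D + 2 : ℕ) : ℝ) ^ s ≤ D) (t : ℕ → Set ℝ)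
    (ht : ∑' n, (⨆ _ : (t n).Nonempty, Metric.ediam (t n) ^ s) <
      ENNReal.ofReal ((((D + 2 : ℕ) : ℝ) ^ (-s)) ^ 2 / 8)) :
    ∃ (m : ℕ → ℕ) (N : ℕ → Finset ℕ), (∀ n, 1 ≤ m n) ∧
      (∀ n, ∀ z ∈ t n, ∀ w ∈ t n, |z - w| ≤ (((D + 2 : ℕ) : ℝ) ^ m n)⁻¹) ∧
      (∀ k n, m n = k + 1 → n ∈ N k) ∧ ∀ k, 4 * (N k).card ≤ D ^ k := by
  set M : ℝ := ((D + 2 : ℕ) : ℝ) with hM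
  set ρ : ℝ := M ^ (-s) with hρ
  have hM1 : 1 < M := by rw [hM]; exact_mod_cast (show 1 < D + 2 by omega)
  have hM0 : 0 < M := by linarith
  have hρ0 : 0 < ρ := Real.rpow_pos_of_pos hM0 _
  have hρ1 : ρ < 1 := Real.rpow_lt_one_of_one_lt_of_neg hM1 (by linarith)
  have hρD : 1 ≤ ρ * D := by
    have : ρ * M ^ s = 1 := by rw [hρ, ← Real.rpow_add hM0]; simp
    calc (1 : ℝ) = ρ * M ^ s := this.symm
      _ ≤ ρ * D := mul_le_mul_of_nonneg_left hDs hρ0.le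
  have hε : ENNReal.ofReal (ρ ^ 2 / 8) ≠ 0 := by
    rw [Ne, ENNReal.ofReal_eq_zero, not_le]; positivity
  -- The summable perturbation `η` makes every `e n` positive, so that sets of zero diameter also
  -- get a finite level.
  obtain ⟨η, hη0, hη⟩ := ENNReal.exists_pos_sum_of_countable' hε ℕ
  set e : ℕ → ENNReal := fun n => (⨆ _ : (t n).Nonempty, Metric.ediam (t n) ^ s) + η n with he
  have hsum : ∑' n, e n ≤ ENNReal.ofReal (ρ ^ 2 / 4) := by
    rw [he, ENNReal.tsum_add]
    refine (add_le_add ht.le hη.le).trans ?_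
    rw [← ENNReal.ofReal_add (by positivity) (by positivity)]
    exact ENNReal.ofReal_le_ofReal (by linarith)
  have hen : ∀ n, e n ≤ ENNReal.ofReal (ρ ^ 2 / 4) := fun n => (ENNReal.le_tsum n).trans hsum
  have hefin : ∀ n, e n ≠ ⊤ := fun n => ne_top_of_le_ne_top ENNReal.ofReal_ne_top (hen n)
  have he0 : ∀ n, 0 < (e n).toReal := fun n =>
    ENNReal.toReal_pos ((hη0 n).trans_le le_add_self).ne' (hefin n)
  have heρ : ∀ n, (e n).toReal ≤ ρ ^ 2 / 4 := fun n =>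
    ENNReal.toReal_le_of_le_ofReal (by positivity) (hen n)
  choose m hm1 hm2 using fun n => exists_nat_pow_near_of_lt_one (he0 n)
    ((heρ n).trans (by nlinarith)) hρ0 hρ1
  -- Level `k + 1` means `e n > ρ ^ (k + 2)`; a total of at most `ρ ^ 2 / 4` leaves room for at most
  -- `ρ⁻ᵏ / 4 ≤ D ^ k / 4` such `n`.
  choose hf hcard using fun k : ℕ => ENNReal.finset_card_const_le_le_of_tsum_le
    ENNReal.ofReal_ne_top hsum (ε := ENNReal.ofReal (ρ ^ (k + 2)))
    (by rw [Ne, ENNReal.ofReal_eq_zero, not_le]; positivity)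
  refine ⟨m, fun k => (hf k).toFinset, fun n => ?_, fun n z hz w hw => ?_, fun k n hn => ?_,
    fun k => ?_⟩
  · by_contra hlt
    have h0 : m n = 0 := by omega
    have := hm1 n
    rw [h0, zero_add, pow_one] at this
    have := heρ n
    have := mul_lt_mul_of_pos_left hρ1 hρ0
    nlinarith
  · have h1 : Metric.ediam (t n) ^ s ≤ ENNReal.ofReal (ρ ^ m n) := by
      calc Metric.ediam (t n) ^ s ≤ e n := by
            rw [he]
            refine le_trans ?_ le_self_add
            exact le_iSup (fun _ : (t n).Nonempty => Metric.ediam (t n) ^ s) ⟨z, hz⟩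
        _ = ENNReal.ofReal (e n).toReal := (ENNReal.ofReal_toReal (hefin n)).symm
        _ ≤ _ := ENNReal.ofReal_le_ofReal (hm2 n)
    have h2 : edist z w ^ s ≤ ENNReal.ofReal (ρ ^ m n) :=
      (ENNReal.rpow_le_rpow (Metric.edist_le_ediam_of_mem hz hw) hs.le).trans h1
    rw [edist_dist, ENNReal.ofReal_rpow_of_nonneg dist_nonneg hs.le,
      ENNReal.ofReal_le_ofReal_iff (by positivity), Real.dist_eq] at h2
    have h3 : ρ ^ m n = ((M ^ m n)⁻¹) ^ s := by
      rw [hρ, ← Real.rpow_natCast, ← Real.rpow_natCast, ← Real.rpow_neg hM0.le,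
        ← Real.rpow_mul hM0.le, ← Real.rpow_mul hM0.le]
      ring_nf
    rw [h3] at h2
    exact (Real.rpow_le_rpow_iff (abs_nonneg _) (by positivity) hs).1 h2
  · rw [Set.Finite.mem_toFinset, Set.mem_ofPred_eq]
    have := (hm1 n).le
    rw [hn] at this
    exact ENNReal.ofReal_le_of_le_toReal this
  · have h1 := hcard k
    rw [← ENNReal.ofReal_div_of_pos (by positivity), ← ENNReal.ofReal_natCast,
      ENNReal.ofReal_le_ofReal_iff (by positivity), le_div_iff₀ (by positivity)] at h1
    have h2 : 1 ≤ (ρ * D) ^ k := one_le_pow₀ hρD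
    have h3 : ((4 * (hf k).toFinset.card : ℕ) : ℝ) * ρ ^ k ≤ ((D ^ k : ℕ) : ℝ) * ρ ^ k := by
      push_cast
      rw [mul_pow] at h2
      have h5 : (4 * ((hf k).toFinset.card : ℝ) * ρ ^ k) * ρ ^ 2 ≤ 1 * ρ ^ 2 := by
        have := pow_add ρ k 2
        nlinarith
      have := le_of_mul_le_mul_right h5 (by positivity)
      linarith
    exact_mod_cast le_of_mul_le_mul_right h3 (by positivity)

open scoped NNReal in
/-- The points of `[0, 1]` outside a countable family of sparse sets form a set of large
Hausdorff dimension. -/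
theorem le_dimH_avoiding_sparse {s : ℝ≥0} (hs : 0 < s) {D : ℕ} (hD : 2 ≤ D)
    (hDs : ((D + 2 : ℕ) : ℝ) ^ (s : ℝ) ≤ D) (Z : ℕ → ℕ → Set ℝ) (R q : ℕ → ℕ)
    (hZ : ∀ i p, IsSparseAt (D + 2) p (q i) (R i) (Z i p)) (hq : ∀ i, i + 1 ≤ q i)
    (hR : ∀ i, 4 * R i * 2 ^ (i + 1) ≤ D ^ (q i - 1)) :
    (s : ENNReal) ≤ dimH {y ∈ Set.Icc (0 : ℝ) 1 | ∀ i p, y ∉ Z i p} := by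
  by_contra! hlt
  have h0 := hausdorffMeasure_of_dimH_lt hlt
  rw [MeasureTheory.Measure.hausdorffMeasure_apply] at h0
  have h1 := (ENNReal.iSup_eq_zero.1 (ENNReal.iSup_eq_zero.1 h0 1)) one_pos
  have hpos : (0 : ENNReal) < ENNReal.ofReal ((((D + 2 : ℕ) : ℝ) ^ (-(s : ℝ))) ^ 2 / 8) := by
    rw [ENNReal.ofReal_pos]
    positivity
  rw [← h1] at hpos
  simp only [iInf_lt_iff] at hpos
  obtain ⟨t, hcov, -, ht⟩ := hpos
  obtain ⟨m, N, hm, hdiam, hN, hNcard⟩ := exists_level_of_tsum_lt hs hD hDs t ht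
  obtain ⟨y, hy, hyZ, hyt⟩ := exists_avoiding_sparse (by omega) Z R q hZ hq hR t m hm hdiam N hN
    hNcard
  obtain ⟨n, hn⟩ := Set.mem_iUnion.1 (hcov ⟨hy, hyZ⟩)
  exact hyt n hn

/-! ### Orbit of `1` and laps of the iterates of the `β`-map. -/

lemma betaMap_mem_Ico (β x : ℝ) : betaMap β x ∈ Set.Ico (0 : ℝ) 1 :=
  ⟨Int.fract_nonneg _, Int.fract_lt_one _⟩

lemma iterate_betaMap_mem_Ico (β : ℝ) {y : ℝ} (hy : y ∈ Set.Ico (0 : ℝ) 1) (n : ℕ) :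
    (betaMap β)^[n] y ∈ Set.Ico (0 : ℝ) 1 := by
  cases n with
  | zero => exact hy
  | succ n => rw [Function.iterate_succ_apply']; exact betaMap_mem_Ico _ _

lemma iterate_betaMap_one_nonneg (β : ℝ) (n : ℕ) : 0 ≤ (betaMap β)^[n] 1 := by
  cases n with
  | zero => simp
  | succ n => rw [Function.iterate_succ_apply']; exact (betaMap_mem_Ico _ _).1

lemma iterate_betaMap_one_le_one (β : ℝ) (n : ℕ) : (betaMap β)^[n] 1 ≤ 1 := by
  cases n with
  | zero => simp
  | succ n => rw [Function.iterate_succ_apply']; exact (betaMap_mem_Ico _ _).2.le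

/-- If the expansion of `1` terminates, its orbit reaches `0`. -/
lemma OneExpansionTerminates.exists_iterate_eq_zero {β : ℝ} (hβ : 1 < β)
    (h : OneExpansionTerminates β) : ∃ k, ∀ n, k ≤ n → (betaMap β)^[n] 1 = 0 := by
  obtain ⟨k, hk⟩ := h
  refine ⟨k, fun n hn => ?_⟩
  -- With zero digits the map is multiplication by `β`, so a positive value would eventually exceed
  -- 1.
  have hmul : ∀ m, (betaMap β)^[n + m] 1 = β ^ m * (betaMap β)^[n] 1 := by
    intro m
    induction m with
    | zero => simp
    | succ m ih =>
      have hd := hk (n + m) (by omega)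
      rw [betaDigit] at hd
      rw [← add_assoc, Function.iterate_succ_apply', betaMap, Int.fract, hd, ih, pow_succ']
      push_cast
      ring
  by_contra hne
  have hpos := lt_of_le_of_ne (iterate_betaMap_one_nonneg β n) (Ne.symm hne)
  obtain ⟨m, hm⟩ := pow_unbounded_of_one_lt (1 / (betaMap β)^[n] 1) hβ
  rw [div_lt_iff₀ hpos, ← hmul] at hm
  exact absurd (iterate_betaMap_one_le_one β (n + m)) (not_le.2 hm)

/-- The orbit of `1` takes finitely many values. The constant `c` bounds the lengths of the images
of laps from below. -/
lemma OneExpansionTerminates.exists_pos_le_iterate {β : ℝ} (hβ : 1 < β)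
    (h : OneExpansionTerminates β) :
    ∃ c : ℝ, 0 < c ∧ ∀ j, 0 < (betaMap β)^[j] 1 → c ≤ (betaMap β)^[j] 1 := by
  obtain ⟨k, hk⟩ := h.exists_iterate_eq_zero hβ
  let F := ((Finset.range k).image fun j => (betaMap β)^[j] 1).filter (0 < ·)
  rcases F.eq_empty_or_nonempty with hF | hF
  · refine ⟨1, one_pos, fun j hj => ?_⟩
    exfalso
    have : (betaMap β)^[j] 1 ∈ F := Finset.mem_filter.2 ⟨Finset.mem_image_of_mem _
      (Finset.mem_range.2 (not_le.1 fun hkj => hj.ne' (hk j hkj))), hj⟩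
    simp [hF] at this
  · refine ⟨F.min' hF, (Finset.mem_filter.1 (F.min'_mem hF)).2, fun j hj => F.min'_le _ ?_⟩
    exact Finset.mem_filter.2 ⟨Finset.mem_image_of_mem _
      (Finset.mem_range.2 (not_le.1 fun hkj => hj.ne' (hk j hkj))), hj⟩

/-- The left endpoint of the interval of continuity of `f_βⁿ` that contains `y`. -/
noncomputable def lapLeft (β : ℝ) (n : ℕ) (y : ℝ) : ℝ := y - (betaMap β)^[n] y / β ^ n

/-- The lap of `f_βⁿ` around `y` is mapped linearly onto `[0, v)`, where `v` lies in the orbit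
of `1`. -/
lemma exists_lap {β : ℝ} (hβ : β ∈ Set.Ioo (1 : ℝ) 2) {y : ℝ} (hy : y ∈ Set.Ico (0 : ℝ) 1)
    (n : ℕ) : ∃ j, (betaMap β)^[n] y < (betaMap β)^[j] 1 ∧
      ∀ z, 0 ≤ β ^ n * (z - lapLeft β n y) → β ^ n * (z - lapLeft β n y) < (betaMap β)^[j] 1 →
        (betaMap β)^[n] z = β ^ n * (z - lapLeft β n y) := by
  obtain ⟨hβ1, hβ2⟩ := hβ
  have hβ0 : 0 < β := by linarith
  induction n with
  | zero => exact ⟨0, by simpa using hy.2, fun z _ _ => by simp [lapLeft]⟩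
  | succ n ih =>
    obtain ⟨j, hj, hlin⟩ := ih
    obtain ⟨ht0, ht1⟩ := iterate_betaMap_mem_Ico β hy n
    set t := (betaMap β)^[n] y with ht
    set v := (betaMap β)^[j] 1 with hv
    have hv1 : v ≤ 1 := iterate_betaMap_one_le_one β j
    have hbt : β * t < β * v := mul_lt_mul_of_pos_left hj hβ0
    have hbv : β * v < 2 := by nlinarith
    have hsucc : ∀ z, (betaMap β)^[n + 1] z = Int.fract (β * (betaMap β)^[n] z) := fun z => by
      rw [Function.iterate_succ_apply', betaMap]
    have hpow : 0 < β ^ n := by positivity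
    have hleft : ∀ z, β ^ (n + 1) * (z - lapLeft β (n + 1) y) =
        β * (β ^ n * (z - lapLeft β n y)) - (β * t - Int.fract (β * t)) := by
      intro z
      rw [lapLeft, lapLeft, hsucc, ← ht]
      field_simp
      ring
    have hback : ∀ z r, β * (β ^ n * (z - lapLeft β n y)) = r → 0 ≤ r → r < β * v →
        (betaMap β)^[n + 1] z = Int.fract r := by
      intro z r hr h0 h1
      rw [hsucc, hlin z, hr]
      · rw [← hr] at h0
        exact nonneg_of_mul_nonneg_right h0 hβ0
      · rw [← hr] at h1
        exact lt_of_mul_lt_mul_left h1 hβ0.le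
    have hvsucc : (betaMap β)^[j + 1] 1 = Int.fract (β * v) := by
      rw [Function.iterate_succ_apply', betaMap]
    -- As `β * v < 2`, the image `[0, v)` is cut at most once, at `1 / β`. The left piece maps onto
    -- `[0, min (β * v) 1)`, whose end is the next orbit point of `1` or `1` itself; the right piece
    -- maps onto `[0, β * v - 1)`.
    rcases lt_or_ge (β * t) 1 with hlt | hge
    · have hfr : Int.fract (β * t) = β * t := Int.fract_eq_self.2 ⟨by positivity, hlt⟩
      have key : ∀ u, u ≤ β * v → u ≤ 1 → ∀ z, 0 ≤ β ^ (n + 1) * (z - lapLeft β (n + 1) y) →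
          β ^ (n + 1) * (z - lapLeft β (n + 1) y) < u →
          (betaMap β)^[n + 1] z = β ^ (n + 1) * (z - lapLeft β (n + 1) y) := by
        intro u hu1 hu2 z h0 h1
        rw [hback z (β ^ (n + 1) * (z - lapLeft β (n + 1) y)) (by rw [hleft, hfr]; ring) h0
          (h1.trans_le hu1)]
        exact Int.fract_eq_self.2 ⟨h0, h1.trans_le hu2⟩
      rcases lt_or_ge (β * v) 1 with hv' | hv'
      · have hfv : Int.fract (β * v) = β * v :=
          Int.fract_eq_self.2 ⟨by nlinarith, hv'⟩
        refine ⟨j + 1, ?_, ?_⟩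
        · rw [hsucc, ← ht, hfr, hvsucc, hfv]; exact hbt
        · rw [hvsucc, hfv]; exact key _ le_rfl hv'.le
      · refine ⟨0, ?_, ?_⟩
        · rw [hsucc, ← ht, hfr]; simpa using hlt
        · exact key _ (by simpa using hv') (by simp)
    · have hfr : Int.fract (β * t) = β * t - 1 := by
        rw [Int.fract_eq_iff]
        exact ⟨by linarith, by linarith, 1, by push_cast; ring⟩
      have hfv : Int.fract (β * v) = β * v - 1 := by
        rw [Int.fract_eq_iff]
        exact ⟨by linarith, by linarith, 1, by push_cast; ring⟩
      refine ⟨j + 1, ?_, fun z h0 h1 => ?_⟩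
      · rw [hsucc, ← ht, hfr, hvsucc, hfv]; linarith
      · rw [hvsucc, hfv] at h1
        rw [hback z (β ^ (n + 1) * (z - lapLeft β (n + 1) y) + 1) (by rw [hleft, hfr]; ring)
          (by linarith) (by linarith), Int.fract_add_one]
        exact Int.fract_eq_self.2 ⟨h0, by linarith⟩

/-- Left endpoints of distinct laps are separated. -/
lemma lapLeft_le_of_lt {β c : ℝ} (hβ : β ∈ Set.Ioo (1 : ℝ) 2)
    (hc : ∀ j, 0 < (betaMap β)^[j] 1 → c ≤ (betaMap β)^[j] 1) {y z : ℝ}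
    (hy : y ∈ Set.Ico (0 : ℝ) 1) (hz : z ∈ Set.Ico (0 : ℝ) 1) {n : ℕ}
    (h : lapLeft β n y < lapLeft β n z) : c ≤ β ^ n * (lapLeft β n z - lapLeft β n y) := by
  obtain ⟨j, hj, hjl⟩ := exists_lap hβ hy n
  obtain ⟨i, hi, hil⟩ := exists_lap hβ hz n
  have hβ0 : 0 < β := by linarith [hβ.1]
  have hpos : 0 < β ^ n * (lapLeft β n z - lapLeft β n y) :=
    mul_pos (by positivity) (by linarith)
  refine (hc j ((iterate_betaMap_mem_Ico β hy n).1.trans_lt hj)).trans ?_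
  -- Otherwise the left endpoint of the lap of `z` lies inside the lap of `y`, where the iterate is
  -- positive, yet its own lap gives 0 there.
  by_contra! hlt
  have h1 := hjl (lapLeft β n z) hpos.le hlt
  have h2 := hil (lapLeft β n z) (by simp)
    (by simpa using (iterate_betaMap_mem_Ico β hz n).1.trans_lt hi)
  rw [sub_self, mul_zero] at h2
  linarith

/-! ### Sparseness of the visits and the conclusion. -/

/-- The points of `[0, 1)` which at a time `n` with `Mᵖ ≤ βⁿ < Mᵖ⁺¹` come `δ`-close to `x`. -/
def visitSet (β x δ : ℝ) (M p : ℕ) : Set ℝ :=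
  {y | y ∈ Set.Ico (0 : ℝ) 1 ∧ ∃ n : ℕ, (M : ℝ) ^ p ≤ β ^ n ∧ β ^ n < (M : ℝ) ^ (p + 1) ∧
    |(betaMap β)^[n] y - x| < δ}

/-- `R = T * N` does not depend on `q`: `T` bounds the number of times `n` in the window, and `N`
the number of laps met, whose left endpoints lie in a range of length at most `(M + 1) / β ^ n` and
are `c / β ^ n` apart. -/
lemma exists_isSparseAt_visitSet {β : ℝ} (hβ : β ∈ Set.Ioo (1 : ℝ) 2)
    (hterm : OneExpansionTerminates β) (x : ℝ) {M : ℕ} (hM : 0 < M) :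
    ∃ R : ℕ, ∀ q : ℕ, ∃ δ : ℝ, 0 < δ ∧ ∀ p, IsSparseAt M p q R (visitSet β x δ M p) := by
  classical
  obtain ⟨c, hc0, hc⟩ := hterm.exists_pos_le_iterate hβ.1
  have hβ0 : 0 < β := by linarith [hβ.1]
  have hM0 : (0 : ℝ) < M := by exact_mod_cast hM
  obtain ⟨T, hT⟩ := pow_unbounded_of_one_lt (M : ℝ) hβ.1
  set N := ⌊((M : ℝ) + 1) / c⌋₊ + 1 with hN
  refine ⟨T * N, fun q => ⟨((M : ℝ) ^ q)⁻¹ / 2, by positivity, fun p j => ?_⟩⟩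
  set δ := ((M : ℝ) ^ q)⁻¹ / 2 with hδ
  have hex : ∃ n : ℕ, (M : ℝ) ^ p ≤ β ^ n :=
    (pow_unbounded_of_one_lt ((M : ℝ) ^ p) hβ.1).imp fun _ h => h.le
  set n₀ := Nat.find hex with hn₀
  -- Index of the cell of length `c / β ^ n` containing the left endpoint; for fixed `n`, equal
  -- codes force equal laps.
  let code : ℕ → ℝ → ℕ := fun n z =>
    ⌊(lapLeft β n z - ((j : ℝ) / (M : ℝ) ^ p - 1 / β ^ n)) * (β ^ n / c)⌋₊
  have hnonneg : ∀ n, ∀ z ∈ Set.Ico (0 : ℝ) 1 ∩ adicInterval M p j,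
      0 ≤ (lapLeft β n z - ((j : ℝ) / (M : ℝ) ^ p - 1 / β ^ n)) * (β ^ n / c) := by
    rintro n z ⟨hz, hz1, -⟩
    refine mul_nonneg ?_ (by positivity)
    have : (betaMap β)^[n] z / β ^ n ≤ 1 / β ^ n := by
      gcongr
      exact (iterate_betaMap_mem_Ico β hz n).2.le
    rw [lapLeft]
    linarith
  let K : ℕ × ℕ → Set ℝ := fun a =>
    {z | z ∈ Set.Ico (0 : ℝ) 1 ∩ adicInterval M p j ∧ (M : ℝ) ^ p ≤ β ^ a.1 ∧
      |(betaMap β)^[a.1] z - x| < δ ∧ code a.1 z = a.2}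
  refine ⟨(Finset.Ico n₀ (n₀ + T) ×ˢ Finset.range N).image K, ?_, ?_, ?_⟩
  · refine Finset.card_image_le.trans ?_
    simp
  · rintro z ⟨⟨hz, n, hn1, hn2, hn3⟩, hzj⟩
    refine ⟨K (n, code n z), Finset.mem_image_of_mem _ ?_, ⟨hz, hzj⟩, hn1, hn3, rfl⟩
    rw [Finset.mem_product, Finset.mem_Ico, Finset.mem_range]
    have hle : n₀ ≤ n := Nat.find_min' hex hn1
    refine ⟨⟨hle, ?_⟩, ?_⟩
    · by_contra! hlt
      have h1 : β ^ (n₀ + T) ≤ β ^ n := pow_le_pow_right₀ hβ.1.le hlt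
      have h2 : (M : ℝ) ^ p ≤ β ^ n₀ := Nat.find_spec hex
      have h3 : (M : ℝ) ^ p * M ≤ β ^ n₀ * β ^ T :=
        mul_le_mul h2 hT.le hM0.le (by positivity)
      rw [← pow_succ, ← pow_add] at h3
      linarith
    · refine Nat.lt_succ_of_le (Nat.floor_le_floor ?_)
      rw [mul_div_assoc']
      refine div_le_div_of_nonneg_right ?_ hc0.le
      have h1 : lapLeft β n z ≤ ((j : ℝ) + 1) / (M : ℝ) ^ p := by
        have : 0 ≤ (betaMap β)^[n] z / β ^ n :=
          div_nonneg (iterate_betaMap_mem_Ico β hz n).1 (by positivity)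
        rw [lapLeft]
        linarith [hzj.2]
      have h2 : β ^ n / (M : ℝ) ^ p ≤ M := by
        rw [div_le_iff₀ (by positivity), ← pow_succ']
        exact hn2.le
      calc _ ≤ (((j : ℝ) + 1) / (M : ℝ) ^ p - ((j : ℝ) / (M : ℝ) ^ p - 1 / β ^ n)) * β ^ n := by
            gcongr
        _ = β ^ n / (M : ℝ) ^ p + 1 := by field_simp; ring
        _ ≤ _ := by linarith
  · intro g hg z hz w hw
    obtain ⟨⟨n, l⟩, -, rfl⟩ := Finset.mem_image.1 hg
    obtain ⟨hz0, hzn, hzx, hzl⟩ := hz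
    obtain ⟨hw0, -, hwx, hwl⟩ := hw
    dsimp only at hzn hzx hzl hwx hwl
    have hsep : ∀ a ∈ Set.Ico (0 : ℝ) 1 ∩ adicInterval M p j,
        ∀ b ∈ Set.Ico (0 : ℝ) 1 ∩ adicInterval M p j, code n a = l → code n b = l →
          ¬ lapLeft β n a < lapLeft β n b := by
      intro a ha b hb hal hbl hlt
      have h1 := lapLeft_le_of_lt hβ hc ha.1 hb.1 hlt
      have h2 := Nat.floor_le (hnonneg n a ha)
      have h3 := Nat.lt_floor_add_one
        ((lapLeft β n b - ((j : ℝ) / (M : ℝ) ^ p - 1 / β ^ n)) * (β ^ n / c))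
      have h4 : (code n a : ℝ) = code n b := by rw [hal, hbl]
      have h5 : 1 ≤ (lapLeft β n b - lapLeft β n a) * (β ^ n / c) := by
        rw [mul_div_assoc', le_div_iff₀ hc0]
        linarith
      simp only [code] at h4
      linarith
    have heq : lapLeft β n z = lapLeft β n w :=
      le_antisymm (not_lt.1 (hsep w hw0 z hz0 hwl hzl)) (not_lt.1 (hsep z hz0 w hw0 hzl hwl))
    have hdiff : z - w = ((betaMap β)^[n] z - (betaMap β)^[n] w) / β ^ n := by
      rw [lapLeft, lapLeft] at heq
      rw [sub_div]
      linarith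
    rw [hdiff, abs_div, abs_of_pos (show (0 : ℝ) < β ^ n by positivity), pow_add, mul_inv_rev,
      ← div_eq_mul_inv]
    refine div_le_div₀ (by positivity) ?_ (by positivity) hzn
    rw [abs_le]
    rw [abs_lt] at hzx hwx
    constructor <;> linarith [hzx.1, hzx.2, hwx.1, hwx.2]

/-- Every `β ^ n ≥ 1` falls in some window `[Mᵖ, Mᵖ⁺¹)`, so the whole orbit stays at distance at
least `δ` from `x`. -/
lemma mem_avoidingSet_of_forall_notMem_visitSet {β x δ : ℝ} (hβ : 1 ≤ β) (hδ : 0 < δ) {M : ℕ}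
    (hM : 1 < M) {y : ℝ} (hy : y ∈ Set.Ico (0 : ℝ) 1) (h : ∀ p, y ∉ visitSet β x δ M p) :
    y ∈ avoidingSet (betaMap β) x := by
  refine ⟨hy, fun hx => ?_⟩
  obtain ⟨_, ⟨n, rfl⟩, hn⟩ := Metric.mem_closure_iff.1 hx δ hδ
  obtain ⟨p, hp1, hp2⟩ := exists_nat_pow_near (one_le_pow₀ hβ : 1 ≤ β ^ n)
    (show (1 : ℝ) < M by exact_mod_cast hM)
  refine h p ⟨hy, n, hp1, hp2, ?_⟩
  rwa [← Real.dist_eq, dist_comm]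

open scoped NNReal in
theorem mainTheorem4 (β : ℕ → ℝ) (x : ℕ → ℝ)
    (hβ : ∀ i, β i ∈ Set.Ioo (1 : ℝ) 2)
    (hterm : ∀ i, OneExpansionTerminates (β i))
    (hx : ∀ i, x i ∈ Set.Icc (0 : ℝ) 1) :
    dimH (⋂ i, avoidingSet (betaMap (β i)) (x i)) = 1 := by
  refine le_antisymm ((dimH_mono (Set.subset_univ _)).trans_eq Real.dimH_univ) ?_
  refine ENNReal.le_of_forall_nnreal_lt fun s hs => ?_
  rcases eq_or_ne s 0 with rfl | hs0
  · simp
  have hs1 : (s : ℝ) < 1 := by exact_mod_cast hs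
  obtain ⟨D, hD, hDs⟩ := exists_nat_rpow_le hs1
  choose R hR using fun i => exists_isSparseAt_visitSet (hβ i) (hterm i) (x i)
    (M := D + 2) (by omega)
  -- This `q i`, chosen after `R i`, gives `D ^ (q i - 1) ≥ 2 ^ (4 * R i) * 2 ^ (i + 1)`, since `D ≥
  -- 2`.
  choose δ hδ0 hδ using fun i => hR i (4 * R i + i + 2)
  have hdim := le_dimH_avoiding_sparse (pos_iff_ne_zero.2 hs0) hD hDs
    (fun i p => visitSet (β i) (x i) (δ i) (D + 2) p) R (fun i => 4 * R i + i + 2) hδ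
    (fun i => by omega) (fun i => by
      calc 4 * R i * 2 ^ (i + 1) ≤ 2 ^ (4 * R i) * 2 ^ (i + 1) :=
            Nat.mul_le_mul_right _ Nat.lt_two_pow_self.le
        _ = 2 ^ (4 * R i + i + 2 - 1) := by rw [← pow_add]; rfl
        _ ≤ _ := Nat.pow_le_pow_left hD _)
  have hsub : {y ∈ Set.Icc (0 : ℝ) 1 | ∀ i p, y ∉ visitSet (β i) (x i) (δ i) (D + 2) p} ⊆
      (⋂ i, avoidingSet (betaMap (β i)) (x i)) ∪ {1} := by
    rintro y ⟨hy, hyZ⟩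
    rcases hy.2.lt_or_eq with hlt | rfl
    · exact Or.inl (Set.mem_iInter.2 fun i => mem_avoidingSet_of_forall_notMem_visitSet
        (hβ i).1.le (hδ0 i) (by omega) ⟨hy.1, hlt⟩ (hyZ i))
    · exact Or.inr rfl
  refine hdim.trans ((dimH_mono hsub).trans ?_)
  rw [dimH_union, dimH_singleton]
  simp
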